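/- All $C^*$-algebras and their morphisms are unital. Let $u=(u_{ij})$ be an $n\times n$ matrix over a $C^*$-algebra, $u^t=(u_{ji})$ its transpose, and $\bar u=(u_{ij}^*)$. Call $u$ *magic* if $u=\bar u$, $u^t=u^{-1}$, $ab=0$ for any two distinct entries $a,b$ on the same row or on the same column (entries are distinguished by their positions), and all entries are projections ($a^2=a=a^*$). Call $u$ *magik* if $u$ and $u^t$ are both unitary, $ab^*=a^*b=0$ for any two distinct entries $a,b$ on the same row or on the same column, and all row sums and all column sums of $u$ are equal to one and the same element. Let $A_s(n)$ (Wang's quantum permutation algebra) be the universal $C^*$-algebra generated by the entries of an $n\times n$ magic matrix $v=(v_{ij})$, and let $A_p(n)$ be the universal $C^*$-algebra generated by the entries of an $n\times n$ magik matrix $u=(u_{ij})$. Let $z\in C(\mathbb T)$, $z(x)=x$, be the identity function of the unit circle, and let $*$ denote the full free product of unital $C^*$-algebras, with the units identified. **Corollary 4.5.** For every $n\ge 1$ we have $A_p(n)=C(\mathbb T)*A_s(n)$: there is a $*$-isomorphism $A_p(n)\to C(\mathbb T)*A_s(n)$ which maps $u_{ij}\mapsto z\,v_{ij}$ for all $i,j$.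 -/

import Mathlib

universe u

noncomputable section

/-! # The free unital complex *-algebra on a set -/

/-- The free unital complex `*`-algebra on `X`: noncommutative polynomials in the letters
`x = inl x` and their formal adjoints `x* = inr x`. -/
def FreeStarAlgebra (X : Type u) : Type u := FreeAlgebra ℂ (X ⊕ X)

namespace FreeStarAlgebra

variable {X : Type u}

instance : Ring (FreeStarAlgebra X) := inferInstanceAs (Ring (FreeAlgebra ℂ (X ⊕ X)))

instance : Algebra ℂ (FreeStarAlgebra X) := inferInstanceAs (Algebra ℂ (FreeAlgebra ℂ (X ⊕ X)))

/-- The letter `x`. -/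
def gen (x : X) : FreeStarAlgebra X := FreeAlgebra.ι ℂ (Sum.inl x)

/-- The formal adjoint of the letter `x`. -/
def genStar (x : X) : FreeStarAlgebra X := FreeAlgebra.ι ℂ (Sum.inr x)

theorem induction {p : FreeStarAlgebra X → Prop}
    (hc : ∀ c : ℂ, p (algebraMap ℂ _ c)) (hg : ∀ x, p (gen x)) (hs : ∀ x, p (genStar x))
    (hm : ∀ a b, p a → p b → p (a * b)) (ha : ∀ a b, p a → p b → p (a + b))
    (a : FreeStarAlgebra X) : p a :=
  FreeAlgebra.induction ℂ (X ⊕ X) (motive := p) hc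
    (fun x => by cases x with
      | inl x => exact hg x
      | inr x => exact hs x) hm ha a

/-- The opposite algebra with complex scalars acting through complex conjugation. -/
abbrev conjOpAlgebra (X : Type u) : Algebra ℂ (FreeStarAlgebra X)ᵐᵒᵖ :=
  ((algebraMap ℂ (FreeStarAlgebra X)ᵐᵒᵖ).comp (starRingEnd ℂ)).toAlgebra'
    (fun c x => Algebra.commutes (starRingEnd ℂ c) x)

/-- The conjugate-linear antimultiplicative map exchanging `x` and `x*`. -/
def starHom : FreeStarAlgebra X →+* (FreeStarAlgebra X)ᵐᵒᵖ :=
  letI := conjOpAlgebra X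
  (FreeAlgebra.lift ℂ
    (Sum.elim (fun x : X => MulOpposite.op (genStar x))
      (fun x : X => MulOpposite.op (gen x)))).toRingHom

theorem starHom_gen (x : X) : starHom (gen x) = MulOpposite.op (genStar x) := by
  let _ := conjOpAlgebra X
  exact FreeAlgebra.lift_ι_apply (R := ℂ) _ (Sum.inl x)

theorem starHom_genStar (x : X) : starHom (genStar x) = MulOpposite.op (gen x) := by
  let _ := conjOpAlgebra X
  exact FreeAlgebra.lift_ι_apply (R := ℂ) _ (Sum.inr x)

theorem starHom_algebraMap (c : ℂ) :
    starHom (algebraMap ℂ (FreeStarAlgebra X) c) =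
      MulOpposite.op (algebraMap ℂ (FreeStarAlgebra X) (star c)) := by
  let _ := conjOpAlgebra X
  exact AlgHom.commutes (FreeAlgebra.lift ℂ
    (Sum.elim (fun x : X => MulOpposite.op (genStar x))
      (fun x : X => MulOpposite.op (gen x)))) c

instance : StarRing (FreeStarAlgebra X) where
  star a := (starHom a).unop
  star_involutive a := by
    induction a using induction with
    | hc c => simp [starHom_algebraMap]
    | hg x => simp [starHom_gen, starHom_genStar]
    | hs x => simp [starHom_gen, starHom_genStar]
    | hm a b ha hb => simp only [map_mul, MulOpposite.unop_mul, ha, hb]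
    | ha a b ha hb => simp only [map_add, MulOpposite.unop_add, ha, hb]
  star_mul a b := by simp only [map_mul, MulOpposite.unop_mul]
  star_add a b := by simp only [map_add, MulOpposite.unop_add]

theorem star_gen (x : X) : star (gen x) = genStar x :=
  congrArg MulOpposite.unop (starHom_gen x)

theorem star_genStar (x : X) : star (genStar x) = gen x :=
  congrArg MulOpposite.unop (starHom_genStar x)

theorem star_algebraMap (c : ℂ) :
    star (algebraMap ℂ (FreeStarAlgebra X) c) = algebraMap ℂ (FreeStarAlgebra X) (star c) :=
  congrArg MulOpposite.unop (starHom_algebraMap c)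

instance : StarModule ℂ (FreeStarAlgebra X) where
  star_smul c a := by
    rw [Algebra.smul_def, star_mul, star_algebraMap, Algebra.smul_def, Algebra.commutes]

/-- Evaluation of noncommutative `*`-polynomials at a family of elements of a `*`-algebra. -/
def eval {A : Type*} [Ring A] [StarRing A] [Algebra ℂ A] [StarModule ℂ A] (f : X → A) :
    FreeStarAlgebra X →⋆ₐ[ℂ] A where
  __ := (FreeAlgebra.lift ℂ (Sum.elim f fun x => star (f x)) :
      FreeAlgebra ℂ (X ⊕ X) →ₐ[ℂ] A)
  map_star' a := by
    set L : FreeStarAlgebra X →ₐ[ℂ] A :=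
      (FreeAlgebra.lift ℂ (Sum.elim f fun x => star (f x)) :
        FreeAlgebra ℂ (X ⊕ X) →ₐ[ℂ] A)
    have h1 (x : X) : L (gen x) = f x := FreeAlgebra.lift_ι_apply (R := ℂ) _ (Sum.inl x)
    have h2 (x : X) : L (genStar x) = star (f x) :=
      FreeAlgebra.lift_ι_apply (R := ℂ) _ (Sum.inr x)
    change L (star a) = star (L a)
    induction a using induction with
    | hc c => rw [star_algebraMap, AlgHom.commutes, AlgHom.commutes, algebraMap_star_comm]
    | hg x => rw [star_gen, h1, h2]
    | hs x => rw [star_genStar, h1, h2, star_star]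
    | hm a b ha hb => rw [star_mul, map_mul, ha, hb, map_mul, star_mul]
    | ha a b ha hb => rw [star_add, map_add, ha, hb, map_add, star_add]

theorem eval_gen {A : Type*} [Ring A] [StarRing A] [Algebra ℂ A] [StarModule ℂ A] (f : X → A)
    (x : X) : eval f (gen x) = f x :=
  FreeAlgebra.lift_ι_apply (R := ℂ) _ (Sum.inl x)

end FreeStarAlgebra

/-! # Universal C*-algebras -/

/-- Conditions on a family of elements, indexed by `X`, of a unital C*-algebra, which bound the
norm of each element of the family, uniformly over all families that satisfy them. All conditions
used below amount to the vanishing of a set of `*`-polynomials in the elements of the family. -/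
structure CStarRelations (X : Type u) where
  /-- the family `f` satisfies the conditions -/
  Holds : ∀ {A : Type u} [CStarAlgebra A], (X → A) → Prop
  bounded : ∀ x : X, ∃ c : ℝ, ∀ (A : Type u) [CStarAlgebra A] (f : X → A), Holds f → ‖f x‖ ≤ c

namespace CStarRelations

variable {X : Type u} (R : CStarRelations X)

/-- A representation of the relations: a family in some unital C*-algebra satisfying them. -/
structure Rep where
  carrier : Type u
  [cstar : CStarAlgebra carrier]
  family : X → carrier
  holds : R.Holds family

attribute [instance] Rep.cstar

/-- The evaluation of `*`-polynomials in a representation. -/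
def Rep.eval {R : CStarRelations X} (r : R.Rep) : FreeStarAlgebra X →⋆ₐ[ℂ] r.carrier :=
  FreeStarAlgebra.eval r.family

/-- The universal C*-seminorm on `*`-polynomials: the supremum of the norms in all
representations. -/
def universalNorm (a : FreeStarAlgebra X) : ℝ := ⨆ r : R.Rep, ‖r.eval a‖

theorem bddAbove_norm (a : FreeStarAlgebra X) :
    BddAbove (Set.range fun r : R.Rep => ‖r.eval a‖) := by
  suffices h : ∃ c : ℝ, ∀ r : R.Rep, ‖r.eval a‖ ≤ c by
    obtain ⟨c, hc⟩ := h
    exact ⟨c, by rintro _ ⟨r, rfl⟩; exact hc r⟩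
  induction a using FreeStarAlgebra.induction with
  | hc c =>
    refine ⟨‖c‖ * 1, fun r => ?_⟩
    have h1 : ‖(1 : r.carrier)‖ ≤ 1 := by
      rcases subsingleton_or_nontrivial r.carrier with h | h
      · rw [Subsingleton.elim (1 : r.carrier) 0, norm_zero]; exact zero_le_one
      · exact CStarRing.norm_one.le
    rw [AlgHomClass.commutes, Algebra.algebraMap_eq_smul_one, norm_smul]
    exact mul_le_mul_of_nonneg_left h1 (norm_nonneg c)
  | hg x =>
    obtain ⟨c, hc⟩ := R.bounded x
    refine ⟨c, fun r => ?_⟩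
    rw [Rep.eval, FreeStarAlgebra.eval_gen]
    exact hc _ _ r.holds
  | hs x =>
    obtain ⟨c, hc⟩ := R.bounded x
    refine ⟨c, fun r => ?_⟩
    rw [← FreeStarAlgebra.star_gen, map_star, norm_star, Rep.eval, FreeStarAlgebra.eval_gen]
    exact hc _ _ r.holds
  | hm a b ha hb =>
    obtain ⟨c, hc⟩ := ha
    obtain ⟨d, hd⟩ := hb
    refine ⟨c * d, fun r => ?_⟩
    rw [map_mul]
    exact (norm_mul_le _ _).trans
      (mul_le_mul (hc r) (hd r) (norm_nonneg _) ((norm_nonneg _).trans (hc r)))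
  | ha a b ha hb =>
    obtain ⟨c, hc⟩ := ha
    obtain ⟨d, hd⟩ := hb
    refine ⟨c + d, fun r => ?_⟩
    rw [map_add]
    exact (norm_add_le _ _).trans (add_le_add (hc r) (hd r))

theorem le_universalNorm (r : R.Rep) (a : FreeStarAlgebra X) : ‖r.eval a‖ ≤ R.universalNorm a :=
  le_ciSup (R.bddAbove_norm a) r

theorem universalNorm_nonneg (a : FreeStarAlgebra X) : 0 ≤ R.universalNorm a :=
  Real.iSup_nonneg fun _ => norm_nonneg _

theorem universalNorm_le {a : FreeStarAlgebra X} {c : ℝ} (hc : 0 ≤ c)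
    (h : ∀ r : R.Rep, ‖r.eval a‖ ≤ c) : R.universalNorm a ≤ c :=
  Real.iSup_le h hc

theorem universalNorm_zero : R.universalNorm 0 = 0 :=
  le_antisymm (R.universalNorm_le le_rfl fun r => by rw [map_zero, norm_zero])
    (R.universalNorm_nonneg _)

theorem universalNorm_add (a b : FreeStarAlgebra X) :
    R.universalNorm (a + b) ≤ R.universalNorm a + R.universalNorm b :=
  R.universalNorm_le (add_nonneg (R.universalNorm_nonneg a) (R.universalNorm_nonneg b))
    fun r => by
      rw [map_add]
      exact (norm_add_le _ _).trans (add_le_add (R.le_universalNorm r a) (R.le_universalNorm r b))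

theorem universalNorm_neg (a : FreeStarAlgebra X) : R.universalNorm (-a) = R.universalNorm a := by
  simp only [universalNorm, map_neg, norm_neg]

theorem universalNorm_mul (a b : FreeStarAlgebra X) :
    R.universalNorm (a * b) ≤ R.universalNorm a * R.universalNorm b :=
  R.universalNorm_le (mul_nonneg (R.universalNorm_nonneg a) (R.universalNorm_nonneg b))
    fun r => by
      rw [map_mul]
      exact (norm_mul_le _ _).trans (mul_le_mul (R.le_universalNorm r a) (R.le_universalNorm r b)
        (norm_nonneg _) (R.universalNorm_nonneg a))

theorem universalNorm_smul (c : ℂ) (a : FreeStarAlgebra X) :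
    R.universalNorm (c • a) ≤ ‖c‖ * R.universalNorm a :=
  R.universalNorm_le (mul_nonneg (norm_nonneg c) (R.universalNorm_nonneg a)) fun r => by
    rw [map_smul, norm_smul]
    exact mul_le_mul_of_nonneg_left (R.le_universalNorm r a) (norm_nonneg c)

theorem universalNorm_star (a : FreeStarAlgebra X) :
    R.universalNorm (star a) = R.universalNorm a := by
  simp only [universalNorm, map_star, norm_star]

theorem universalNorm_sq_le (a : FreeStarAlgebra X) :
    R.universalNorm a * R.universalNorm a ≤ R.universalNorm (star a * a) := by
  have h : R.universalNorm a ≤ √(R.universalNorm (star a * a)) :=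
    R.universalNorm_le (Real.sqrt_nonneg _) fun r => by
      refine Real.le_sqrt_of_sq_le ?_
      rw [sq, ← CStarRing.norm_star_mul_self, ← map_star, ← map_mul]
      exact R.le_universalNorm r _
  calc R.universalNorm a * R.universalNorm a
      ≤ √(R.universalNorm (star a * a)) * √(R.universalNorm (star a * a)) :=
        mul_self_le_mul_self (R.universalNorm_nonneg a) h
    _ = _ := Real.mul_self_sqrt (R.universalNorm_nonneg _)

/-- The free `*`-algebra on `X`, endowed with the universal C*-seminorm. -/
def PreUniversal (_ : CStarRelations X) : Type u := FreeStarAlgebra X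

namespace PreUniversal

instance : SeminormedRing R.PreUniversal :=
  RingSeminorm.toSeminormedRing (R := FreeStarAlgebra X)
    { toFun := R.universalNorm
      map_zero' := R.universalNorm_zero
      add_le' := R.universalNorm_add
      neg' := R.universalNorm_neg
      mul_le' := R.universalNorm_mul }

/-- A `*`-polynomial, as an element of the seminormed algebra. -/
def of : FreeStarAlgebra X ≃+* R.PreUniversal := RingEquiv.refl (FreeStarAlgebra X)

theorem norm_of (a : FreeStarAlgebra X) : ‖of R a‖ = R.universalNorm a := rfl

instance : Algebra ℂ R.PreUniversal := inferInstanceAs (Algebra ℂ (FreeStarAlgebra X))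

instance : NormedAlgebra ℂ R.PreUniversal where
  norm_smul_le := R.universalNorm_smul

instance : StarRing R.PreUniversal := inferInstanceAs (StarRing (FreeStarAlgebra X))

instance : StarModule ℂ R.PreUniversal := inferInstanceAs (StarModule ℂ (FreeStarAlgebra X))

theorem norm_star (a : R.PreUniversal) : ‖star a‖ = ‖a‖ := R.universalNorm_star a

theorem norm_sq_le (a : R.PreUniversal) : ‖a‖ * ‖a‖ ≤ ‖star a * a‖ := R.universalNorm_sq_le a

theorem uniformContinuous_star : UniformContinuous (star : R.PreUniversal → R.PreUniversal) :=
  AddMonoidHomClass.uniformContinuous_of_bound (starAddEquiv : R.PreUniversal ≃+ R.PreUniversal)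
    1 fun a => by rw [one_mul]; exact (norm_star R a).le

end PreUniversal

open UniformSpace

/-- The universal C*-algebra generated by a family, indexed by `X`, subject to the given relations:
the separated completion of the free `*`-algebra for the universal C*-seminorm. -/
def Universal : Type u := Completion R.PreUniversal

namespace Universal

instance : NormedRing R.Universal := inferInstanceAs (NormedRing (Completion R.PreUniversal))

instance : CompleteSpace R.Universal :=
  inferInstanceAs (CompleteSpace (Completion R.PreUniversal))

instance : Algebra ℂ R.Universal := inferInstanceAs (Algebra ℂ (Completion R.PreUniversal))

instance : NormedAlgebra ℂ R.Universal where
  norm_smul_le := norm_smul_le (α := ℂ) (β := Completion R.PreUniversal)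

/-- The canonical map from `*`-polynomials to the universal C*-algebra. -/
def mk : FreeStarAlgebra X →+* R.Universal :=
  (Completion.coeRingHom : R.PreUniversal →+* Completion R.PreUniversal).comp
    (PreUniversal.of R).toRingHom

theorem norm_mk (a : FreeStarAlgebra X) : ‖mk R a‖ = R.universalNorm a :=
  Completion.norm_coe (E := R.PreUniversal) _

theorem denseRange_mk : DenseRange (mk R) := Completion.denseRange_coe (α := R.PreUniversal)

instance : Star R.Universal where
  star := Completion.map (star : R.PreUniversal → R.PreUniversal)

theorem continuous_star : Continuous (star : R.Universal → R.Universal) := Completion.continuous_map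

theorem star_mk (a : FreeStarAlgebra X) : star (mk R a) = mk R (star a) :=
  Completion.map_coe (PreUniversal.uniformContinuous_star R) _

theorem mk_smul (c : ℂ) (a : FreeStarAlgebra X) : mk R (c • a) = c • mk R a :=
  Completion.coe_smul (X := R.PreUniversal) c a

instance : StarRing R.Universal where
  star_involutive a := by
    refine (denseRange_mk R).induction_on a
      (isClosed_eq ((continuous_star R).comp (continuous_star R)) continuous_id) fun a => ?_
    rw [star_mk, star_mk, star_star]
  star_mul a b := by
    have hs := continuous_star R
    refine (denseRange_mk R).induction_on₂
      (isClosed_eq (hs.comp (continuous_fst.mul continuous_snd))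
        ((hs.comp continuous_snd).mul (hs.comp continuous_fst))) (fun a b => ?_) a b
    rw [← map_mul, star_mk, star_mk, star_mk, star_mul, map_mul]
  star_add a b := by
    have hs := continuous_star R
    refine (denseRange_mk R).induction_on₂
      (isClosed_eq (hs.comp (continuous_fst.add continuous_snd))
        ((hs.comp continuous_fst).add (hs.comp continuous_snd))) (fun a b => ?_) a b
    rw [← map_add, star_mk, star_mk, star_mk, star_add, map_add]

instance : StarModule ℂ R.Universal where
  star_smul c a := by
    have hs := continuous_star R
    refine (denseRange_mk R).induction_on a
      (isClosed_eq (hs.comp (continuous_const_smul c)) (hs.const_smul (star c))) fun a => ?_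
    rw [← mk_smul, star_mk, star_mk, star_smul, mk_smul]

instance : CStarRing R.Universal where
  norm_mul_self_le a := by
    have hs := continuous_star R
    refine (denseRange_mk R).induction_on a
      (isClosed_le (continuous_norm.mul continuous_norm)
        (continuous_norm.comp (hs.mul continuous_id))) fun a => ?_
    change _ ≤ ‖star (mk R a) * mk R a‖
    rw [star_mk, ← map_mul, norm_mk, norm_mk]
    exact R.universalNorm_sq_le a

instance : CStarAlgebra R.Universal where

/-- The canonical generators. -/
def gen (x : X) : R.Universal := mk R (FreeStarAlgebra.gen x)

theorem mk_algebraMap (c : ℂ) : mk R (algebraMap ℂ _ c) = algebraMap ℂ R.Universal c := rfl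

/-- Two `*`-polynomials that agree in all representations define the same element. -/
theorem mk_eq_mk {a b : FreeStarAlgebra X} (h : ∀ r : R.Rep, r.eval a = r.eval b) :
    mk R a = mk R b := by
  rw [← sub_eq_zero, ← map_sub, ← norm_le_zero_iff, norm_mk]
  exact R.universalNorm_le le_rfl fun r => by rw [map_sub, h r, sub_self, norm_zero]

end Universal

end CStarRelations

/-! # The unital free product of two C*-algebras -/

/-- The relations on the disjoint union of the C*-algebras `A` and `B` which say that each of
them is mapped by a unital `*`-homomorphism. -/
def freeProductRelations (A B : Type u) [CStarAlgebra A] [CStarAlgebra B] :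
    CStarRelations (A ⊕ B) where
  Holds {C} _ f := ∃ (φ : A →⋆ₐ[ℂ] C) (ψ : B →⋆ₐ[ℂ] C), f = Sum.elim φ ψ
  bounded x := by
    cases x with
    | inl a =>
      refine ⟨‖a‖, ?_⟩
      rintro C _ _ ⟨φ, ψ, rfl⟩
      exact NonUnitalStarAlgHom.norm_apply_le φ a
    | inr b =>
      refine ⟨‖b‖, ?_⟩
      rintro C _ _ ⟨φ, ψ, rfl⟩
      exact NonUnitalStarAlgHom.norm_apply_le ψ b

/-- The full free product `A * B` of unital C*-algebras, with the units identified. -/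
abbrev CStarFreeProduct (A B : Type u) [CStarAlgebra A] [CStarAlgebra B] : Type u :=
  (freeProductRelations A B).Universal

namespace CStarFreeProduct

variable {A B : Type u} [CStarAlgebra A] [CStarAlgebra B]

theorem exists_eval (r : (freeProductRelations A B).Rep) :
    ∃ (φ : A →⋆ₐ[ℂ] r.carrier) (ψ : B →⋆ₐ[ℂ] r.carrier),
      (∀ a, r.eval (FreeStarAlgebra.gen (Sum.inl a)) = φ a) ∧
      (∀ b, r.eval (FreeStarAlgebra.gen (Sum.inr b)) = ψ b) := by
  obtain ⟨φ, ψ, h⟩ := r.holds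
  exact ⟨φ, ψ, fun a => (FreeStarAlgebra.eval_gen _ _).trans (congrFun h (Sum.inl a)),
    fun b => (FreeStarAlgebra.eval_gen _ _).trans (congrFun h (Sum.inr b))⟩

open CStarRelations.Universal

/-- The canonical unital `*`-homomorphism `A → A * B`. -/
def inl : A →⋆ₐ[ℂ] CStarFreeProduct A B where
  toFun a := gen (freeProductRelations A B) (Sum.inl a)
  map_one' := by
    rw [← map_one (mk _)]
    refine mk_eq_mk _ fun r => ?_
    obtain ⟨φ, ψ, h, -⟩ := exists_eval r
    rw [h, map_one, map_one]
  map_mul' a b := by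
    rw [gen, gen, gen, ← map_mul]
    refine mk_eq_mk _ fun r => ?_
    obtain ⟨φ, ψ, h, -⟩ := exists_eval r
    rw [map_mul, h, h, h, map_mul]
  map_zero' := by
    rw [← map_zero (mk _)]
    refine mk_eq_mk _ fun r => ?_
    obtain ⟨φ, ψ, h, -⟩ := exists_eval r
    rw [h, map_zero, map_zero]
  map_add' a b := by
    rw [gen, gen, gen, ← map_add]
    refine mk_eq_mk _ fun r => ?_
    obtain ⟨φ, ψ, h, -⟩ := exists_eval r
    rw [map_add, h, h, h, map_add]
  commutes' c := by
    rw [← mk_algebraMap]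
    refine mk_eq_mk _ fun r => ?_
    obtain ⟨φ, ψ, h, -⟩ := exists_eval r
    rw [h, AlgHomClass.commutes, AlgHomClass.commutes]
  map_star' a := by
    rw [gen, gen, star_mk]
    refine mk_eq_mk _ fun r => ?_
    obtain ⟨φ, ψ, h, -⟩ := exists_eval r
    rw [map_star, h, h, map_star]

/-- The canonical unital `*`-homomorphism `B → A * B`. -/
def inr : B →⋆ₐ[ℂ] CStarFreeProduct A B where
  toFun b := gen (freeProductRelations A B) (Sum.inr b)
  map_one' := by
    rw [← map_one (mk _)]
    refine mk_eq_mk _ fun r => ?_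
    obtain ⟨φ, ψ, -, h⟩ := exists_eval r
    rw [h, map_one, map_one]
  map_mul' a b := by
    rw [gen, gen, gen, ← map_mul]
    refine mk_eq_mk _ fun r => ?_
    obtain ⟨φ, ψ, -, h⟩ := exists_eval r
    rw [map_mul, h, h, h, map_mul]
  map_zero' := by
    rw [← map_zero (mk _)]
    refine mk_eq_mk _ fun r => ?_
    obtain ⟨φ, ψ, -, h⟩ := exists_eval r
    rw [h, map_zero, map_zero]
  map_add' a b := by
    rw [gen, gen, gen, ← map_add]
    refine mk_eq_mk _ fun r => ?_
    obtain ⟨φ, ψ, -, h⟩ := exists_eval r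
    rw [map_add, h, h, h, map_add]
  commutes' c := by
    rw [← mk_algebraMap]
    refine mk_eq_mk _ fun r => ?_
    obtain ⟨φ, ψ, -, h⟩ := exists_eval r
    rw [h, AlgHomClass.commutes, AlgHomClass.commutes]
  map_star' a := by
    rw [gen, gen, star_mk]
    refine mk_eq_mk _ fun r => ?_
    obtain ⟨φ, ψ, -, h⟩ := exists_eval r
    rw [map_star, h, h, map_star]

end CStarFreeProduct

/-! # Magic and magik matrices -/

section Matrices

open Matrix

variable {n : ℕ} {A : Type*} [Ring A] [StarRing A]

/-- `u` has self-adjoint entries and `uᵗ = u⁻¹`. -/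
def IsOrthogonalMatrix (u : Matrix (Fin n) (Fin n) A) : Prop :=
  (∀ i j, star (u i j) = u i j) ∧ uᵀ * u = 1 ∧ u * uᵀ = 1

/-- `u` is orthogonal, and `ab = 0` for distinct entries `a, b` on the same row or column. -/
def IsCubicMatrix (u : Matrix (Fin n) (Fin n) A) : Prop :=
  IsOrthogonalMatrix u ∧
    (∀ i j k, j ≠ k → u i j * u i k = 0) ∧ (∀ i j k, i ≠ j → u i k * u j k = 0)

/-- `u` is cubic, and its entries are projections. -/
def IsMagicMatrix (u : Matrix (Fin n) (Fin n) A) : Prop :=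
  IsCubicMatrix u ∧ ∀ i j, u i j * u i j = u i j ∧ star (u i j) = u i j

/-- `u` and its transpose are unitary. -/
def IsBiunitaryMatrix (u : Matrix (Fin n) (Fin n) A) : Prop :=
  (uᴴ * u = 1 ∧ u * uᴴ = 1) ∧ (uᵀᴴ * uᵀ = 1 ∧ uᵀ * uᵀᴴ = 1)

/-- `u` is biunitary, and `ab* = a*b = 0` for distinct entries `a, b` on the same row or column. -/
def IsCubikMatrix (u : Matrix (Fin n) (Fin n) A) : Prop :=
  IsBiunitaryMatrix u ∧
    (∀ i j k, j ≠ k → u i j * star (u i k) = 0 ∧ star (u i j) * u i k = 0) ∧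
    (∀ i j k, i ≠ j → u i k * star (u j k) = 0 ∧ star (u i k) * u j k = 0)

/-- `u` is cubik, and all row sums and all column sums are equal to one and the same element. -/
def IsMagikMatrix (u : Matrix (Fin n) (Fin n) A) : Prop :=
  IsCubikMatrix u ∧ ∃ s : A, (∀ i, ∑ j, u i j = s) ∧ (∀ j, ∑ i, u i j = s)

/-- The entries of a cubik matrix are partial isometries. -/
theorem IsCubikMatrix.partialIsometry {u : Matrix (Fin n) (Fin n) A} (hu : IsCubikMatrix u)
    (i j : Fin n) : u i j * star (u i j) * u i j = u i j := by
  obtain ⟨⟨⟨-, hu1⟩, -⟩, hr, -⟩ := hu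
  have h1 : ∑ k, u i k * star (u i k) = 1 := by
    have h : (u * uᴴ) i i = (1 : Matrix (Fin n) (Fin n) A) i i := by rw [hu1]
    simpa only [Matrix.mul_apply, Matrix.conjTranspose_apply, Matrix.one_apply_eq] using h
  have h2 := congrArg (· * u i j) h1
  simp only [Finset.sum_mul, one_mul] at h2
  rw [Finset.sum_eq_single j] at h2
  · exact h2
  · intro k _ hk
    rw [mul_assoc, (hr i k j hk).2, mul_zero]
  · intro h
    exact absurd (Finset.mem_univ j) h

end Matrices

theorem norm_le_one_of_partialIsometry {A : Type*} [CStarAlgebra A] {a : A}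
    (h : a * star a * a = a) : ‖a‖ ≤ 1 := by
  have h1 : ‖star a * a‖ = ‖a‖ * ‖a‖ := CStarRing.norm_star_mul_self
  have h2 : ‖star (star a * a) * (star a * a)‖ = ‖star a * a‖ * ‖star a * a‖ :=
    CStarRing.norm_star_mul_self
  have h3 : star (star a * a) * (star a * a) = star a * a := by
    rw [star_mul, star_star, mul_assoc, ← mul_assoc a, h]
  rw [h3, h1] at h2
  by_contra! h4
  nlinarith [mul_pos (zero_lt_one.trans h4) (zero_lt_one.trans h4), mul_self_nonneg (‖a‖ - 1)]

/-- The relations which say that the `n × n` matrix of generators is magic. -/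
def magicRelations (n : ℕ) : CStarRelations (Fin n × Fin n) where
  Holds f := IsMagicMatrix (Matrix.of fun i j => f (i, j))
  bounded x := ⟨1, fun _ _ f hf => norm_le_one_of_partialIsometry (by
    obtain ⟨h1, h2⟩ := hf.2 x.1 x.2
    change f x * f x = f x at h1
    change star (f x) = f x at h2
    rw [h2, h1, h1])⟩

/-- The relations which say that the `n × n` matrix of generators is magik. -/
def magikRelations (n : ℕ) : CStarRelations (Fin n × Fin n) where
  Holds f := IsMagikMatrix (Matrix.of fun i j => f (i, j))
  bounded x := ⟨1, fun _ _ _ hf =>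
    norm_le_one_of_partialIsometry (IsCubikMatrix.partialIsometry hf.1 x.1 x.2)⟩

/-- The universal C*-algebra generated by the entries of an `n × n` magic matrix: Wang's quantum
permutation algebra. -/
abbrev QuantumPermutationAlgebra (n : ℕ) : Type := (magicRelations n).Universal

/-- The universal C*-algebra generated by the entries of an `n × n` magik matrix. -/
abbrev MagikAlgebra (n : ℕ) : Type := (magikRelations n).Universal

/-- The matrix of canonical generators of the quantum permutation algebra. -/
def magicMatrix (n : ℕ) : Matrix (Fin n) (Fin n) (QuantumPermutationAlgebra n) :=
  Matrix.of fun i j => CStarRelations.Universal.gen (magicRelations n) (i, j)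

/-- The matrix of canonical generators of the universal algebra of a magik matrix. -/
def magikMatrix (n : ℕ) : Matrix (Fin n) (Fin n) (MagikAlgebra n) :=
  Matrix.of fun i j => CStarRelations.Universal.gen (magikRelations n) (i, j)

/-- The identity function `z(x) = x` on the unit circle. -/
def circleCoordinate : C(Circle, ℂ) := ⟨fun x => (x : ℂ), continuous_subtype_val⟩

end

/-! Over any C*-algebra, an `n × n` magik matrix with `n ≥ 1` is the same thing as a unitary
together with a magic matrix. If `u` is magik with common sum `s`, expand `s` along row `i`: the
cross terms vanish, so `s* u_ij = u_ij* u_ij` and `s u_ij* = u_ij u_ij*`. Summing over `j`, the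
unitarity of `uᵗ` and of `u` gives `s* s = 1` and `s s* = 1`. The entries of `u` are partial
isometries, so the elements `s* u_ij` are projections; they are orthogonal along rows and columns,
and each row and column sums to `s* s = 1`. Conversely, `z v` is magik with common sum `z`. This is
`IsMagikMatrix.exists_unitary` and `IsMagicMatrix.unitary_mul`.

The universal properties turn this correspondence into homomorphisms `f : u_ij ↦ z v_ij` and `g : z
↦ s, v_ij ↦ s* u_ij`, which are inverse to each other on generators. They require that the canonical
generators satisfy their own relations (representations separate points, `ext_liftRep`) and that
`C(𝕋)` is universal for a unitary. -/

noncomputable section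

/-! ### Universal property of a C*-algebra given by relations. -/

namespace CStarRelations.Universal

variable {X : Type u} {R : CStarRelations X}

theorem continuous_starAlgHom {A B : Type*} [CStarAlgebra A] [CStarAlgebra B]
    (φ : A →⋆ₐ[ℂ] B) : Continuous φ :=
  AddMonoidHomClass.continuous_of_bound φ 1 fun a => by
    rw [one_mul]; exact NonUnitalStarAlgHom.norm_apply_le φ a

/-- The universal seminorm is a supremum over all representations, so each evaluation is
contractive; hence it extends to the completion. -/
theorem continuous_eval (r : R.Rep) :
    Continuous (r.eval.toRingHom.comp (PreUniversal.of R).symm.toRingHom :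
      R.PreUniversal →+* r.carrier) :=
  AddMonoidHomClass.continuous_of_bound _ 1 fun a => by
    rw [one_mul]; exact R.le_universalNorm r a

/-- The `*`-homomorphism from the universal C*-algebra defined by a representation. -/
def liftRep (r : R.Rep) : R.Universal →⋆ₐ[ℂ] r.carrier :=
  let F : R.Universal →+* r.carrier :=
    UniformSpace.Completion.extensionHom _ (continuous_eval r)
  have hF : Continuous F := UniformSpace.Completion.continuous_extension
  have hmk (a : FreeStarAlgebra X) : F (mk R a) = r.eval a :=
    UniformSpace.Completion.extensionHom_coe _ (continuous_eval r) _
  { F with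
    commutes' c := by
      change F _ = _
      rw [← mk_algebraMap, hmk, AlgHomClass.commutes]
    map_star' a := by
      change F (star a) = star (F a)
      refine (denseRange_mk R).induction_on a
        (isClosed_eq (hF.comp (continuous_star R)) hF.star) fun a => ?_
      rw [star_mk, hmk, hmk, map_star] }

theorem liftRep_mk (r : R.Rep) (a : FreeStarAlgebra X) : liftRep r (mk R a) = r.eval a :=
  UniformSpace.Completion.extensionHom_coe _ (continuous_eval r) _

theorem liftRep_gen (r : R.Rep) (x : X) : liftRep r (gen R x) = r.family x :=
  (liftRep_mk r _).trans (FreeStarAlgebra.eval_gen _ _)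

/-- The representations separate the points of the universal C*-algebra. -/
theorem ext_liftRep {x y : R.Universal} (h : ∀ r : R.Rep, liftRep r x = liftRep r y) : x = y := by
  rw [← sub_eq_zero, ← norm_le_zero_iff]
  refine le_of_forall_pos_le_add fun ε hε => ?_
  obtain ⟨a, ha⟩ := (denseRange_mk R).exists_dist_lt (x - y) (half_pos hε)
  rw [dist_eq_norm] at ha
  -- Every representation kills `x - y`, so on `a` it sees only the approximation error, which
  -- therefore bounds the universal norm of `a`.
  have h1 : ‖mk R a‖ ≤ ‖x - y - mk R a‖ := by
    rw [norm_mk]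
    refine R.universalNorm_le (norm_nonneg _) fun r => ?_
    have h2 : liftRep r (x - y - mk R a) = -r.eval a := by
      rw [map_sub, map_sub, h r, sub_self, zero_sub, liftRep_mk]
    rw [← norm_neg, ← h2]
    exact NonUnitalStarAlgHom.norm_apply_le (liftRep r) _
  have h3 := norm_add_le (x - y - mk R a) (mk R a)
  rw [sub_add_cancel] at h3
  linarith

/-- The `*`-homomorphism from the universal C*-algebra defined by a family that satisfies the
relations. -/
def lift {A : Type u} [CStarAlgebra A] (f : X → A) (hf : R.Holds f) : R.Universal →⋆ₐ[ℂ] A :=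
  liftRep ⟨A, f, hf⟩

theorem lift_gen {A : Type u} [CStarAlgebra A] (f : X → A) (hf : R.Holds f) (x : X) :
    lift f hf (gen R x) = f x :=
  liftRep_gen (R := R) ⟨A, f, hf⟩ x

/-- The `*`-polynomials in the generators are dense, and `*`-homomorphisms are continuous. -/
theorem starAlgHom_ext {A : Type*} [CStarAlgebra A] {φ ψ : R.Universal →⋆ₐ[ℂ] A}
    (h : ∀ x, φ (gen R x) = ψ (gen R x)) : φ = ψ := by
  refine DFunLike.coe_injective ((denseRange_mk R).equalizer (continuous_starAlgHom φ)
    (continuous_starAlgHom ψ) (funext fun a => ?_))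
  change φ (mk R a) = ψ (mk R a)
  induction a using FreeStarAlgebra.induction with
  | hc c => rw [mk_algebraMap, AlgHomClass.commutes, AlgHomClass.commutes]
  | hg x => exact h x
  | hs x =>
    rw [← FreeStarAlgebra.star_gen, ← star_mk, map_star, map_star]
    exact congrArg star (h x)
  | hm a b ha hb => rw [map_mul, map_mul, map_mul, ha, hb]
  | ha a b ha hb => rw [map_add, map_add, map_add, ha, hb]

end CStarRelations.Universal

/-! ### Universal property of the free product. -/

namespace CStarFreeProduct

open CStarRelations.Universal

variable {A B C : Type u} [CStarAlgebra A] [CStarAlgebra B] [CStarAlgebra C]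

/-- The universal property of the free product. -/
theorem exists_lift (φ : A →⋆ₐ[ℂ] C) (ψ : B →⋆ₐ[ℂ] C) :
    ∃ g : CStarFreeProduct A B →⋆ₐ[ℂ] C, (∀ a, g (inl a) = φ a) ∧ ∀ b, g (inr b) = ψ b :=
  have h : (freeProductRelations A B).Holds (Sum.elim φ ψ) := ⟨φ, ψ, rfl⟩
  ⟨CStarRelations.Universal.lift _ h, fun a => lift_gen _ h (Sum.inl a),
    fun b => lift_gen _ h (Sum.inr b)⟩

theorem starAlgHom_ext {φ ψ : CStarFreeProduct A B →⋆ₐ[ℂ] C}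
    (hl : φ.comp inl = ψ.comp inl) (hr : φ.comp inr = ψ.comp inr) : φ = ψ :=
  CStarRelations.Universal.starAlgHom_ext fun x => by
    cases x with
    | inl a => exact DFunLike.congr_fun hl a
    | inr b => exact DFunLike.congr_fun hr b

end CStarFreeProduct

/-! ### `C(𝕋)` as the universal C*-algebra of a unitary. -/

section Circle

theorem star_circleCoordinate_mul : star circleCoordinate * circleCoordinate = 1 := by
  ext x
  change star (x : ℂ) * (x : ℂ) = 1
  rw [mul_comm]
  exact (Complex.mul_conj _).trans (by rw [Circle.normSq_coe, Complex.ofReal_one])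

theorem circleCoordinate_mul_star : circleCoordinate * star circleCoordinate = 1 := by
  rw [mul_comm, star_circleCoordinate_mul]

/-- A unital `*`-homomorphism on `C(𝕋)` is determined by the image of the coordinate. -/
theorem starAlgHom_ext_circle {A : Type*} [CStarAlgebra A] {φ ψ : C(Circle, ℂ) →⋆ₐ[ℂ] A}
    (h : φ circleCoordinate = ψ circleCoordinate) : φ = ψ :=
  -- `Circle` unfolds to this subtype of `ℂ`, so the Stone–Weierstrass uniqueness statement for
  -- compact subsets applies, with the polynomial `X` as coordinate.
  have : CompactSpace ((Submonoid.unitSphere ℂ : Set ℂ) : Type) :=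
    inferInstanceAs (CompactSpace Circle)
  have hX : Polynomial.toContinuousMapOnAlgHom (Submonoid.unitSphere ℂ : Set ℂ) Polynomial.X =
      circleCoordinate := by
    ext x
    exact Polynomial.eval_X
  ContinuousMap.starAlgHom_ext_map_X (𝕜 := ℂ) (s := (Submonoid.unitSphere ℂ : Set ℂ))
    (CStarRelations.Universal.continuous_starAlgHom φ)
    (CStarRelations.Universal.continuous_starAlgHom ψ)
    ((congrArg φ hX).trans (h.trans (congrArg ψ hX).symm))

/-- The functional calculus of a unitary, as a `*`-homomorphism on `C(𝕋)`. -/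
theorem exists_starAlgHom_circle {A : Type*} [CStarAlgebra A] {s : A} (hs : s ∈ unitary A) :
    ∃ φ : C(Circle, ℂ) →⋆ₐ[ℂ] A, φ circleCoordinate = s := by
  have hn : IsStarNormal s := ⟨by
    rw [Commute, SemiconjBy, (Unitary.mem_iff.1 hs).1, (Unitary.mem_iff.1 hs).2]⟩
  -- Functions on the circle restrict to the spectrum of `s`, where the coordinate becomes the
  -- identity function, whose functional calculus is `s`.
  have hsub := Unitary.spectrum_subset_circle (𝕜 := ℂ) (⟨s, hs⟩ : unitary A)
  let g : C(spectrum ℂ s, Circle) :=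
    ⟨fun x => ⟨x.1, hsub x.2⟩, Continuous.subtype_mk continuous_subtype_val _⟩
  exact ⟨(cfcHom hn).comp (ContinuousMap.compStarAlgHom' ℂ ℂ g), cfcHom_id hn⟩

end Circle

section Matrices

open Matrix

variable {n : ℕ}

/-! ### The canonical generators satisfy their relations. -/

section Separating

variable {A : Type*} [CStarAlgebra A] {ι : Type*} {B : ι → Type*} [∀ r, CStarAlgebra (B r)]

theorem matrix_ext_of_separating (φ : ∀ r, A →⋆ₐ[ℂ] B r)
    (hφ : ∀ x y : A, (∀ r, φ r x = φ r y) → x = y) {a b : Matrix (Fin n) (Fin n) A}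
    (h : ∀ r, a.map (φ r) = b.map (φ r)) : a = b :=
  Matrix.ext fun i j => hφ _ _ fun r => congrFun (congrFun (h r) i) j

/-- A matrix is magic if its images under a separating family of `*`-homomorphisms are. -/
theorem IsMagicMatrix.of_separating (φ : ∀ r, A →⋆ₐ[ℂ] B r)
    (hφ : ∀ x y : A, (∀ r, φ r x = φ r y) → x = y) {v : Matrix (Fin n) (Fin n) A}
    (h : ∀ r, IsMagicMatrix (v.map (φ r))) : IsMagicMatrix v := by
  refine ⟨⟨⟨fun i j => hφ _ _ fun r => ?_, matrix_ext_of_separating φ hφ fun r => ?_,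
    matrix_ext_of_separating φ hφ fun r => ?_⟩, fun i j k hjk => hφ _ _ fun r => ?_,
    fun i j k hij => hφ _ _ fun r => ?_⟩,
    fun i j => ⟨hφ _ _ fun r => ?_, hφ _ _ fun r => ?_⟩⟩ <;>
    obtain ⟨⟨⟨h1, h2, h3⟩, h4, h5⟩, h6⟩ := h r <;>
    have hst (x : A) : φ r (star x) = star (φ r x) := map_star (φ r) x
  · simpa [hst] using h1 i j
  · simpa [Matrix.map_mul, Matrix.transpose_map] using h2
  · simpa [Matrix.map_mul, Matrix.transpose_map] using h3
  · simpa using h4 i j k hjk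
  · simpa using h5 i j k hij
  · simpa using (h6 i j).1
  · simpa [hst] using (h6 i j).2

/-- A matrix is magik if its images under a separating family of `*`-homomorphisms are. -/
theorem IsMagikMatrix.of_separating (φ : ∀ r, A →⋆ₐ[ℂ] B r)
    (hφ : ∀ x y : A, (∀ r, φ r x = φ r y) → x = y) (i₀ : Fin n) {u : Matrix (Fin n) (Fin n) A}
    (h : ∀ r, IsMagikMatrix (u.map (φ r))) : IsMagikMatrix u := by
  refine ⟨⟨⟨⟨matrix_ext_of_separating φ hφ fun r => ?_, matrix_ext_of_separating φ hφ fun r => ?_⟩,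
    matrix_ext_of_separating φ hφ fun r => ?_, matrix_ext_of_separating φ hφ fun r => ?_⟩,
    fun i j k hjk => ⟨hφ _ _ fun r => ?_, hφ _ _ fun r => ?_⟩,
    fun i j k hij => ⟨hφ _ _ fun r => ?_, hφ _ _ fun r => ?_⟩⟩,
    -- The common sum is only known to exist in each `B r` separately. Taking row `i₀` as a witness
    -- in `A` makes the condition a set of equations, which can be tested under each `φ r`.
    ∑ j, u i₀ j, fun i => hφ _ _ fun r => ?_, fun j => hφ _ _ fun r => ?_⟩ <;>
    obtain ⟨⟨⟨⟨h1, h2⟩, h3, h4⟩, h5, h6⟩, s, h7, h8⟩ := h r <;>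
    have hst (x : A) : φ r (star x) = star (φ r x) := map_star (φ r) x <;>
    have hct (a : Matrix (Fin n) (Fin n) A) : aᴴ.map (φ r) = (a.map (φ r))ᴴ :=
      Matrix.ext fun i j => hst (a j i)
  · simpa [Matrix.map_mul, hct] using h1
  · simpa [Matrix.map_mul, hct] using h2
  · simpa [Matrix.map_mul, hct, Matrix.transpose_map] using h3
  · simpa [Matrix.map_mul, hct, Matrix.transpose_map] using h4
  · simpa [hst] using (h5 i j k hjk).1
  · simpa [hst] using (h5 i j k hjk).2
  · simpa [hst] using (h6 i j k hij).1
  · simpa [hst] using (h6 i j k hij).2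
  · simpa using (h7 i).trans (h7 i₀).symm
  · simpa using (h8 j).trans (h7 i₀).symm

end Separating

/-- Not automatic, since the relations are an arbitrary predicate imposed in representations; they
descend because they are equations and representations separate points. -/
theorem isMagicMatrix_magicMatrix (n : ℕ) : IsMagicMatrix (magicMatrix n) :=
  IsMagicMatrix.of_separating
    (fun r : (magicRelations n).Rep => CStarRelations.Universal.liftRep r)
    (fun _ _ => CStarRelations.Universal.ext_liftRep) fun r => by
    have h : (magicMatrix n).map (CStarRelations.Universal.liftRep r) =
        Matrix.of fun i j => r.family (i, j) :=
      Matrix.ext fun i j => CStarRelations.Universal.liftRep_gen r (i, j)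
    rw [h]
    exact r.holds

theorem isMagikMatrix_magikMatrix (i₀ : Fin n) : IsMagikMatrix (magikMatrix n) :=
  IsMagikMatrix.of_separating
    (fun r : (magikRelations n).Rep => CStarRelations.Universal.liftRep r)
    (fun _ _ => CStarRelations.Universal.ext_liftRep) i₀ fun r => by
    have h : (magikMatrix n).map (CStarRelations.Universal.liftRep r) =
        Matrix.of fun i j => r.family (i, j) :=
      Matrix.ext fun i j => CStarRelations.Universal.liftRep_gen r (i, j)
    rw [h]
    exact r.holds

theorem exists_starAlgHom_of_isMagicMatrix {A : Type} [CStarAlgebra A]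
    {w : Matrix (Fin n) (Fin n) A} (hw : IsMagicMatrix w) :
    ∃ φ : QuantumPermutationAlgebra n →⋆ₐ[ℂ] A, ∀ i j, φ (magicMatrix n i j) = w i j :=
  ⟨CStarRelations.Universal.lift (R := magicRelations n) (fun x => w x.1 x.2) hw, fun i j =>
    CStarRelations.Universal.lift_gen (R := magicRelations n) (fun x => w x.1 x.2) hw (i, j)⟩

theorem exists_starAlgHom_of_isMagikMatrix {A : Type} [CStarAlgebra A]
    {w : Matrix (Fin n) (Fin n) A} (hw : IsMagikMatrix w) :
    ∃ φ : MagikAlgebra n →⋆ₐ[ℂ] A, ∀ i j, φ (magikMatrix n i j) = w i j :=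
  ⟨CStarRelations.Universal.lift (R := magikRelations n) (fun x => w x.1 x.2) hw, fun i j =>
    CStarRelations.Universal.lift_gen (R := magikRelations n) (fun x => w x.1 x.2) hw (i, j)⟩

theorem IsMagicMatrix.map {A B : Type*} [CStarAlgebra A] [CStarAlgebra B] (φ : A →⋆ₐ[ℂ] B)
    {v : Matrix (Fin n) (Fin n) A} (hv : IsMagicMatrix v) : IsMagicMatrix (v.map φ) := by
  have hst (x : A) : star (φ x) = φ (star x) := (map_star φ x).symm
  obtain ⟨⟨⟨h1, h2, h3⟩, h4, h5⟩, h6⟩ := hv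
  refine ⟨⟨⟨fun i j => ?_, ?_, ?_⟩, fun i j k h => ?_, fun i j k h => ?_⟩, fun i j => ?_⟩
  · rw [Matrix.map_apply, hst, h1]
  · rw [← Matrix.transpose_map, ← Matrix.map_mul, h2, Matrix.map_one _ (map_zero φ) (map_one φ)]
  · rw [← Matrix.transpose_map, ← Matrix.map_mul, h3, Matrix.map_one _ (map_zero φ) (map_one φ)]
  · rw [Matrix.map_apply, Matrix.map_apply, ← map_mul, h4 i j k h, map_zero]
  · rw [Matrix.map_apply, Matrix.map_apply, ← map_mul, h5 i j k h, map_zero]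
  · rw [Matrix.map_apply, ← map_mul, hst, (h6 i j).1, (h6 i j).2]
    exact ⟨rfl, rfl⟩

/-! ### Magic matrices multiplied by a unitary. -/

variable {A : Type*} [Ring A] [StarRing A]

theorem IsMagicMatrix.row_sum {v : Matrix (Fin n) (Fin n) A} (hv : IsMagicMatrix v) (i : Fin n) :
    ∑ j, v i j = 1 := by
  obtain ⟨⟨⟨-, -, h⟩, -⟩, h6⟩ := hv
  have h := congrFun (congrFun h i) i
  simpa [Matrix.mul_apply, (h6 _ _).1] using h

theorem IsMagicMatrix.col_sum {v : Matrix (Fin n) (Fin n) A} (hv : IsMagicMatrix v) (j : Fin n) :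
    ∑ i, v i j = 1 := by
  obtain ⟨⟨⟨-, h, -⟩, -⟩, h6⟩ := hv
  have h := congrFun (congrFun h j) j
  simpa [Matrix.mul_apply, (h6 _ _).1] using h

/-- Diagonal entries of `vᵗ v` and `v vᵗ` are sums of squares of idempotents, hence column or row
sums; off-diagonal entries vanish term by term. -/
theorem isMagicMatrix_of_sum_eq_one {v : Matrix (Fin n) (Fin n) A}
    (hs : ∀ i j, star (v i j) = v i j) (hp : ∀ i j, v i j * v i j = v i j)
    (hr : ∀ i j k, j ≠ k → v i j * v i k = 0) (hc : ∀ i j k, i ≠ j → v i k * v j k = 0)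
    (hr' : ∀ i, ∑ j, v i j = 1) (hc' : ∀ j, ∑ i, v i j = 1) : IsMagicMatrix v := by
  refine ⟨⟨⟨hs, ?_, ?_⟩, hr, hc⟩, fun i j => ⟨hp i j, hs i j⟩⟩
  · ext i j
    rcases eq_or_ne i j with rfl | h
    · simp [Matrix.mul_apply, hp, hc']
    · simp [Matrix.mul_apply, h, hr _ _ _ h]
  · ext i j
    rcases eq_or_ne i j with rfl | h
    · simp [Matrix.mul_apply, hp, hr']
    · simp [Matrix.mul_apply, h, hc _ _ _ h]

/-- A magic matrix multiplied by a unitary is magik. -/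
theorem IsMagicMatrix.unitary_mul {v : Matrix (Fin n) (Fin n) A} (hv : IsMagicMatrix v) {z : A}
    (hz : star z * z = 1) (hz' : z * star z = 1) :
    IsMagikMatrix (Matrix.of fun i j => z * v i j) := by
  have hr' := hv.row_sum
  have hc' := hv.col_sum
  obtain ⟨⟨-, hr, hc⟩, hp⟩ := hv
  -- Products with the adjoint on the right are conjugated by `z`; with the adjoint on the left, `z`
  -- cancels. Each condition thus reduces to one on `v`.
  have h1 (i j k l) : z * v i j * star (z * v k l) = z * (v i j * v k l) * star z := by
    rw [star_mul, (hp k l).2]; simp only [mul_assoc]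
  have h2 (i j k l) : star (z * v i j) * (z * v k l) = v i j * v k l := by
    rw [star_mul, (hp i j).2, mul_assoc, ← mul_assoc (star z), hz, one_mul]
  refine ⟨⟨⟨⟨?_, ?_⟩, ?_, ?_⟩, ?_, ?_⟩, z, ?_, ?_⟩
  · ext i j
    simp only [Matrix.mul_apply, conjTranspose_apply, of_apply, h2]
    rcases eq_or_ne i j with rfl | h
    · simp [hp, hc']
    · simp [h, hr _ _ _ h]
  · ext i j
    simp only [Matrix.mul_apply, conjTranspose_apply, of_apply, h1]
    rcases eq_or_ne i j with rfl | h
    · simp [hp, ← Finset.mul_sum, ← Finset.sum_mul, hr', hz']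
    · simp [h, hc _ _ _ h]
  · ext i j
    simp only [Matrix.mul_apply, conjTranspose_apply, transpose_apply, of_apply, h2]
    rcases eq_or_ne i j with rfl | h
    · simp [hp, hr']
    · simp [h, hc _ _ _ h]
  · ext i j
    simp only [Matrix.mul_apply, conjTranspose_apply, transpose_apply, of_apply, h1]
    rcases eq_or_ne i j with rfl | h
    · simp [hp, ← Finset.mul_sum, ← Finset.sum_mul, hc', hz']
    · simp [h, hr _ _ _ h]
  · intro i j k h
    simp only [of_apply, h1, h2]
    simp [hr _ _ _ h]
  · intro i j k h
    simp only [of_apply, h1, h2]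
    simp [hc _ _ _ h]
  · intro i
    simp [← Finset.mul_sum, hr']
  · intro j
    simp [← Finset.mul_sum, hc']

/-- The common row and column sum of a magik matrix is a unitary `s`, and the matrix is the product
of `s` with a magic matrix. -/
theorem IsMagikMatrix.exists_unitary {u : Matrix (Fin n) (Fin n) A} (hu : IsMagikMatrix u)
    (i₀ : Fin n) {s : A} (hsum : ∑ j, u i₀ j = s) :
    s ∈ unitary A ∧ IsMagicMatrix (Matrix.of fun i j => star s * u i j) := by
  have hpi := hu.1.partialIsometry
  obtain ⟨⟨⟨⟨-, hb1⟩, hb2, -⟩, hr, hc⟩, t, ht, ht'⟩ := hu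
  obtain rfl : t = s := (ht i₀).symm.trans hsum
  have e1 (i j) : star t * u i j = star (u i j) * u i j := by
    rw [← ht i, star_sum, Finset.sum_mul]
    exact Finset.sum_eq_single j (fun k _ hk => (hr i k j hk).2) (by simp)
  have e2 (i j) : t * star (u i j) = u i j * star (u i j) := by
    rw [← ht i, Finset.sum_mul]
    exact Finset.sum_eq_single j (fun k _ hk => (hr i k j hk).1) (by simp)
  have s1 : star t * t = 1 := by
    -- Only the right factor is to be expanded: the rewrite unfolds both copies of `t`, and the last
    -- one folds the starred copy back.
    conv_lhs => rw [← ht i₀, ht i₀, ← ht i₀, Finset.mul_sum, ht i₀]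
    simp only [e1]
    -- The unitarity of `uᵗ` is the one needed: its diagonal sums `u_ij* u_ij` along a row, whereas
    -- that of `uᴴ * u` sums along a column.
    have h := congrFun (congrFun hb2 i₀) i₀
    simpa [Matrix.mul_apply] using h
  have s2 : t * star t = 1 := by
    have h := congrFun (congrFun hb1 i₀) i₀
    simp only [Matrix.mul_apply, conjTranspose_apply, ← e2, one_apply_eq] at h
    rwa [← Finset.mul_sum, ← star_sum, ht i₀] at h
  have hst (i j) : star (star t * u i j) = star t * u i j := by
    rw [e1, star_mul, star_star]
  refine ⟨Unitary.mem_iff.2 ⟨s1, s2⟩, isMagicMatrix_of_sum_eq_one ?_ ?_ ?_ ?_ ?_ ?_⟩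
  · exact hst
  · intro i j
    simp only [of_apply]
    rw [e1, mul_assoc, ← mul_assoc (u i j), hpi]
  · intro i j k h
    -- The product becomes `u_ij* (u_ij u_ik*) u_ik`, whose middle factor is zero.
    simp only [of_apply, e1]
    rw [mul_assoc, ← mul_assoc (u i j), (hr i j k h).1, zero_mul, mul_zero]
  · intro i j k h
    simp only [of_apply, e1]
    rw [mul_assoc, ← mul_assoc (u i k), (hc i j k h).1, zero_mul, mul_zero]
  · intro i
    simp only [of_apply, ← Finset.mul_sum, ht, s1]
  · intro j
    simp only [of_apply, ← Finset.mul_sum, ht', s1]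

end Matrices

end

/-! ### The two mutually inverse homomorphisms. -/

theorem corollary4p5 (n : ℕ) (hn : 1 ≤ n) :
    ∃ e : MagikAlgebra n ≃⋆ₐ[ℂ] CStarFreeProduct C(Circle, ℂ) (QuantumPermutationAlgebra n),
      ∀ i j : Fin n, e (magikMatrix n i j) =
        CStarFreeProduct.inl circleCoordinate * CStarFreeProduct.inr (magicMatrix n i j) := by
  set z : CStarFreeProduct C(Circle, ℂ) (QuantumPermutationAlgebra n) :=
    CStarFreeProduct.inl circleCoordinate with hz_def
  have hz : star z * z = 1 := by
    rw [hz_def, ← map_star, ← map_mul, star_circleCoordinate_mul, map_one]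
  have hz' : z * star z = 1 := by
    rw [hz_def, ← map_star, ← map_mul, circleCoordinate_mul_star, map_one]
  -- A row is needed to recover the unitary: for `n = 0` the magik algebra would have no generators,
  -- and nothing would correspond to `z`.
  let i₀ : Fin n := ⟨0, hn⟩
  have hv := (isMagicMatrix_magicMatrix n).map
    (CStarFreeProduct.inr (A := C(Circle, ℂ)) (B := QuantumPermutationAlgebra n))
  obtain ⟨f, hf⟩ := exists_starAlgHom_of_isMagikMatrix (hv.unitary_mul hz hz')
  simp only [Matrix.of_apply, Matrix.map_apply] at hf
  obtain ⟨hs, hm⟩ := (isMagikMatrix_magikMatrix i₀).exists_unitary i₀ rfl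
  have hfs : f (∑ j, magikMatrix n i₀ j) = z := by
    rw [map_sum]
    simp only [hf]
    have h := hv.row_sum i₀
    simp only [Matrix.map_apply] at h
    rw [← Finset.mul_sum, h, mul_one]
  -- From here on, only three facts about the row sum matter: it is unitary, `s* u` is magic, and
  -- `f` sends it to `z`.
  generalize ∑ j, magikMatrix n i₀ j = s at hs hm hfs
  obtain ⟨φ, hφ⟩ := exists_starAlgHom_circle hs
  obtain ⟨ψ, hψ⟩ := exists_starAlgHom_of_isMagicMatrix hm
  obtain ⟨g, hgφ, hgψ⟩ := CStarFreeProduct.exists_lift φ ψ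
  have hgz : g z = s := (hgφ _).trans hφ
  have hgv (i j) : g (CStarFreeProduct.inr (magicMatrix n i j)) = star s * magikMatrix n i j :=
    (hgψ _).trans (hψ i j)
  have hgf : g.comp f = .id ℂ _ :=
    CStarRelations.Universal.starAlgHom_ext fun x => by
      change g (f (magikMatrix n x.1 x.2)) = magikMatrix n x.1 x.2
      rw [hf, map_mul, hgz, hgv, ← mul_assoc, (Unitary.mem_iff.1 hs).2, one_mul]
  have hfg : f.comp g = .id ℂ _ :=
    CStarFreeProduct.starAlgHom_ext
      (starAlgHom_ext_circle (by
        change f (g z) = z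
        rw [hgz, hfs]))
      (CStarRelations.Universal.starAlgHom_ext fun x => by
        change f (g (CStarFreeProduct.inr (magicMatrix n x.1 x.2))) =
          CStarFreeProduct.inr (magicMatrix n x.1 x.2)
        rw [hgv, map_mul, map_star, hfs, hf, ← mul_assoc, hz, one_mul])
  exact ⟨StarAlgEquiv.ofStarAlgHom f g hgf hfg, hf⟩
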